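/- Fix a set $V$ of variables. Terms are built from the variables in $V$ and the constants $C, T, F, K, S$ by binary application, which associates to the left and is not written. Consider the conditional term rewriting system $\mathrm{CLC}$ with the rules \[ \begin{aligned} C\,T\,x\,y &\to x, \\ C\,F\,x\,y &\to y, \\ C\,z\,x\,y &\to x \quad\Leftarrow\quad x = y, \\ K\,x\,y &\to x, \\ S\,x\,y\,z &\to x\,z\,(y\,z), \end{aligned} \] and the system $\mathrm{CLC}^+$ which has all these rules and in addition the rule \[ C\,z\,x\,y \to y \quad\Leftarrow\quad x = y . \] In each of the two systems the equality in the conditions is the equality (convertibility) of that same system. Formally, for $R \in \{\mathrm{CLC}, \mathrm{CLC}^+\}$ let $\to_{R_0}$ be the one-step rewrite relation (rule instances applied in arbitrary contexts) obtained by reading $=$ in the conditions as the empty relation, let $\to_{R_{n+1}}$ be the one-step rewrite relation obtained by reading $=$ as the least equivalence relation containing $\to_{R_n}$, and let $q \to_R q'$ hold if and only if $q \to_{R_n} q'$ for some $n \in \mathbb{N}$. Write $\to_R^*$ for the reflexive-transitive closure of $\to_R$. Then $\mathrm{CLC}$ and $\mathrm{CLC}^+$ are both confluent: for $R = \mathrm{CLC}$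 and for $R = \mathrm{CLC}^+$, whenever $q \to_R^* q_1$ and $q \to_R^* q_2$, there is a term $q'$ with $q_1 \to_R^* q'$ and $q_2 \to_R^* q'$. -/

import Mathlib

/-- The constants of Combinatory Logic with Booleans and a conditional. -/
inductive CLConst : Type
  | C | T | F | K | S

/-- Applicative terms built from the variables in `V` and the constants `C, T, F, K, S`. -/
inductive CLTerm (V : Type*) : Type _
  | var : V → CLTerm V
  | const : CLConst → CLTerm V
  | app : CLTerm V → CLTerm V → CLTerm V

namespace CLTerm

variable {V : Type*}

/-- Application is written `s ⬝ t` and associates to the left. -/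
infixl:90 " ⬝ " => CLTerm.app

abbrev C : CLTerm V := const CLConst.C
abbrev T : CLTerm V := const CLConst.T
abbrev F : CLTerm V := const CLConst.F
abbrev K : CLTerm V := const CLConst.K
abbrev S : CLTerm V := const CLConst.S

end CLTerm

open CLTerm in
/-- `CLCRule E l r`: the pair `(l, r)` is a substitution instance of a rule of `CLC`, where the
equality sign in the condition of the third rule is read as the relation `E`. -/
inductive CLCRule {V : Type*} (E : CLTerm V → CLTerm V → Prop) : CLTerm V → CLTerm V → Prop
  | condT (x y : CLTerm V) : CLCRule E (C ⬝ T ⬝ x ⬝ y) x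
  | condF (x y : CLTerm V) : CLCRule E (C ⬝ F ⬝ x ⬝ y) y
  | condEq (z x y : CLTerm V) : E x y → CLCRule E (C ⬝ z ⬝ x ⬝ y) x
  | ruleK (x y : CLTerm V) : CLCRule E (K ⬝ x ⬝ y) x
  | ruleS (x y z : CLTerm V) : CLCRule E (S ⬝ x ⬝ y ⬝ z) (x ⬝ z ⬝ (y ⬝ z))

open CLTerm in
/-- The rules of `CLC⁺`: those of `CLC` and `C z x y → y ⇐ x = y`. -/
inductive CLCPlusRule {V : Type*} (E : CLTerm V → CLTerm V → Prop) : CLTerm V → CLTerm V → Prop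
  | ofCLC {l r : CLTerm V} : CLCRule E l r → CLCPlusRule E l r
  | condEq' (z x y : CLTerm V) : E x y → CLCPlusRule E (C ⬝ z ⬝ x ⬝ y) y

/-- One-step rewriting: the closure of a set of rule instances under contexts. -/
inductive ContextClosure {V : Type*} (rule : CLTerm V → CLTerm V → Prop) :
    CLTerm V → CLTerm V → Prop
  | root {l r : CLTerm V} : rule l r → ContextClosure rule l r
  | left {s s' : CLTerm V} (t : CLTerm V) :
      ContextClosure rule s s' → ContextClosure rule (s ⬝ t) (s' ⬝ t)
  | right (s : CLTerm V) {t t' : CLTerm V} :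
      ContextClosure rule t t' → ContextClosure rule (s ⬝ t) (s ⬝ t')

/-- The contraction relation of the `n`-th approximation `R_n` of a conditional system `R`, given
by its rules as a function of the relation interpreting equality. In `R_0` equality is read as
the empty relation; in `R_{n+1}` it is read as convertibility in `R_n`. -/
def LevelStep {V : Type*}
    (R : (CLTerm V → CLTerm V → Prop) → CLTerm V → CLTerm V → Prop) :
    ℕ → CLTerm V → CLTerm V → Prop
  | 0 => ContextClosure (R fun _ _ => False)
  | n + 1 => ContextClosure (R (Relation.EqvGen (LevelStep R n)))

/-- The contraction relation `→_R` of a conditional system `R`: contraction at some level. -/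
def CondStep {V : Type*}
    (R : (CLTerm V → CLTerm V → Prop) → CLTerm V → CLTerm V → Prop) (s t : CLTerm V) : Prop :=
  ∃ n : ℕ, LevelStep R n s t

/-- Contraction in `CLC`. -/
def CLCStep {V : Type*} : CLTerm V → CLTerm V → Prop := CondStep CLCRule

/-- Contraction in `CLC⁺`. -/
def CLCPlusStep {V : Type*} : CLTerm V → CLTerm V → Prop := CondStep CLCPlusRule

/-- Confluence: any two reducts of a common term have a common reduct. -/
def IsConfluent {α : Type*} (r : α → α → Prop) : Prop :=
  ∀ a b c : α, Relation.ReflTransGen r a b → Relation.ReflTransGen r a c →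
    ∃ d : α, Relation.ReflTransGen r b d ∧ Relation.ReflTransGen r c d

open CLTerm Relation

namespace CLTerm

variable {V : Type*}

/-! Both systems have the same convertibility `ClcEq`: the extra rule of `CLC⁺` only equates terms
already equal. So it suffices that `ClcEq` terms have a common `CLC` reduct. When `x = y` and `z =
F`, the term `C z x y` may contract to `x` or to `y`, so the rules overlap. `OPar` removes the
choice: its conditions refer to the fixed relation `ClcEq` and `F` has priority. These conditions
are stable under reduction, so complete developments give the triangle property (`OPar.star`), and
`ClcEq` terms are joinable (`ClcEq.join_oPar`). To return to `CLC`, a test provably equal to `T` or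
`F` must reduce to it (`ClcEq.reduces_to_const`). This comes from the evaluation `Ev`, which is
sound for `CLC` reduction and invariant under `ClcEq`. -/

/-- The equational theory of `CLC`. -/
inductive ClcEq : CLTerm V → CLTerm V → Prop
  | refl (s) : ClcEq s s
  | symm {s t} : ClcEq s t → ClcEq t s
  | trans {s t u} : ClcEq s t → ClcEq t u → ClcEq s u
  | app {s s' t t'} : ClcEq s s' → ClcEq t t' → ClcEq (s ⬝ t) (s' ⬝ t')
  | condT (x y) : ClcEq (C ⬝ T ⬝ x ⬝ y) x
  | condF (x y) : ClcEq (C ⬝ F ⬝ x ⬝ y) y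
  | condEq (z) {x y} : ClcEq x y → ClcEq (C ⬝ z ⬝ x ⬝ y) x
  | ruleK (x y) : ClcEq (K ⬝ x ⬝ y) x
  | ruleS (x y z) : ClcEq (S ⬝ x ⬝ y ⬝ z) (x ⬝ z ⬝ (y ⬝ z))

/-! ### The equational theory and convertibility -/

theorem CLCRule.mono {E E' : CLTerm V → CLTerm V → Prop} (h : ∀ s t, E s t → E' s t)
    {l r : CLTerm V} (hr : CLCRule E l r) : CLCRule E' l r := by
  cases hr with
  | condT x y => exact .condT _ _
  | condF x y => exact .condF _ _
  | condEq z x y hxy => exact .condEq _ _ _ (h _ _ hxy)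
  | ruleK x y => exact .ruleK _ _
  | ruleS x y z => exact .ruleS _ _ _

theorem ContextClosure.mono {ρ ρ' : CLTerm V → CLTerm V → Prop} (h : ∀ s t, ρ s t → ρ' s t)
    {s t : CLTerm V} (hst : ContextClosure ρ s t) : ContextClosure ρ' s t := by
  induction hst with
  | root hr => exact .root (h _ _ hr)
  | left t _ ih => exact .left t ih
  | right s _ ih => exact .right s ih

theorem eqvGen_lift {α β : Type*} {r : α → α → Prop} {r' : β → β → Prop} (f : α → β)
    (hf : ∀ a b, r a b → r' (f a) (f b)) {a b : α} (h : EqvGen r a b) :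
    EqvGen r' (f a) (f b) := by
  induction h with
  | rel a b h => exact .rel _ _ (hf _ _ h)
  | refl a => exact .refl _
  | symm a b _ ih => exact .symm _ _ ih
  | trans a b c _ _ ih₁ ih₂ => exact .trans _ _ _ ih₁ ih₂

theorem levelStep_succ {n : ℕ} : ∀ {s t : CLTerm V},
    LevelStep CLCRule n s t → LevelStep CLCRule (n + 1) s t := by
  induction n with
  | zero =>
    exact fun h => ContextClosure.mono (fun _ _ => CLCRule.mono fun _ _ hf => hf.elim) h
  | succ n ih =>
    exact fun h => ContextClosure.mono
      (fun _ _ => CLCRule.mono fun _ _ => eqvGen_lift id fun _ _ => ih) h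

theorem levelStep_mono {m n : ℕ} (hmn : m ≤ n) {s t : CLTerm V}
    (h : LevelStep CLCRule m s t) : LevelStep CLCRule n s t := by
  induction hmn with
  | refl => exact h
  | step _ ih => exact levelStep_succ ih

theorem eqvGen_levelStep_mono {m n : ℕ} (hmn : m ≤ n) {s t : CLTerm V}
    (h : EqvGen (LevelStep CLCRule m) s t) : EqvGen (LevelStep CLCRule n) s t :=
  eqvGen_lift id (fun _ _ => levelStep_mono hmn) h

theorem levelStep_left {n : ℕ} {s s' : CLTerm V} (t : CLTerm V)
    (h : LevelStep CLCRule n s s') : LevelStep CLCRule n (s ⬝ t) (s' ⬝ t) := by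
  cases n <;> exact .left t h

theorem levelStep_right {n : ℕ} (s : CLTerm V) {t t' : CLTerm V}
    (h : LevelStep CLCRule n t t') : LevelStep CLCRule n (s ⬝ t) (s ⬝ t') := by
  cases n <;> exact .right s h

/-- A derivation uses finitely many conditions, and levels are cumulative, so one level serves them
all. -/
theorem ClcEq.exists_level {s t : CLTerm V} (h : ClcEq s t) :
    ∃ n, EqvGen (LevelStep CLCRule n) s t := by
  have base {l r : CLTerm V} (h : CLCRule (fun _ _ => False) l r) :
      ∃ n, EqvGen (LevelStep CLCRule n) l r := ⟨0, .rel _ _ (.root h)⟩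
  induction h with
  | refl s => exact ⟨0, .refl _⟩
  | symm _ ih => exact ih.imp fun _ h => .symm _ _ h
  | trans _ _ ih₁ ih₂ =>
    obtain ⟨m, hm⟩ := ih₁
    obtain ⟨n, hn⟩ := ih₂
    exact ⟨max m n, .trans _ _ _ (eqvGen_levelStep_mono (le_max_left m n) hm)
      (eqvGen_levelStep_mono (le_max_right m n) hn)⟩
  | @app s s' t t' _ _ ih₁ ih₂ =>
    obtain ⟨m, hm⟩ := ih₁
    obtain ⟨n, hn⟩ := ih₂
    exact ⟨max m n, .trans _ (s' ⬝ t) _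
      (eqvGen_lift (· ⬝ t) (fun _ _ => levelStep_left t)
        (eqvGen_levelStep_mono (le_max_left m n) hm))
      (eqvGen_lift (s' ⬝ ·) (fun _ _ => levelStep_right s')
        (eqvGen_levelStep_mono (le_max_right m n) hn))⟩
  | condT x y => exact base (.condT x y)
  | condF x y => exact base (.condF x y)
  | condEq z _ ih =>
    obtain ⟨n, hn⟩ := ih
    exact ⟨n + 1, .rel _ _ (.root (.condEq z _ _ hn))⟩
  | ruleK x y => exact base (.ruleK x y)
  | ruleS x y z => exact base (.ruleS x y z)

/-- The extra rule is derivable: `C z x y = x = y`. -/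
theorem ClcEq.of_rule {E : CLTerm V → CLTerm V → Prop} (hE : ∀ s t, E s t → ClcEq s t)
    {l r : CLTerm V} (h : CLCPlusRule E l r) : ClcEq l r := by
  rcases h with ⟨⟨x, y⟩ | ⟨x, y⟩ | ⟨z, x, y, h⟩ | ⟨x, y⟩ | ⟨x, y, z⟩⟩ | ⟨z, x, y, h⟩
  · exact .condT _ _
  · exact .condF _ _
  · exact .condEq _ (hE _ _ h)
  · exact .ruleK _ _
  · exact .ruleS _ _ _
  · exact .trans (.condEq _ (hE _ _ h)) (hE _ _ h)

theorem ClcEq.of_contextClosure {ρ : CLTerm V → CLTerm V → Prop}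
    (hρ : ∀ s t, ρ s t → ClcEq s t) {s t : CLTerm V} (h : ContextClosure ρ s t) :
    ClcEq s t := by
  induction h with
  | root hr => exact hρ _ _ hr
  | left t _ ih => exact .app ih (.refl t)
  | right s _ ih => exact .app (.refl s) ih

theorem ClcEq.of_eqvGen {r : CLTerm V → CLTerm V → Prop} (hr : ∀ s t, r s t → ClcEq s t)
    {s t : CLTerm V} (h : EqvGen r s t) : ClcEq s t := by
  induction h with
  | rel a b h => exact hr _ _ h
  | refl a => exact .refl _
  | symm a b _ ih => exact .symm ih
  | trans a b c _ _ ih₁ ih₂ => exact .trans ih₁ ih₂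

theorem ClcEq.of_levelStep
    {R : (CLTerm V → CLTerm V → Prop) → CLTerm V → CLTerm V → Prop}
    (hR : ∀ E l r, R E l r → CLCPlusRule E l r) (n : ℕ) :
    ∀ s t, LevelStep R n s t → ClcEq s t := by
  induction n with
  | zero =>
    exact fun s t h => of_contextClosure
      (fun _ _ hr => of_rule (fun _ _ hf => hf.elim) (hR _ _ _ hr)) h
  | succ n ih =>
    exact fun s t h => of_contextClosure
      (fun _ _ hr => of_rule (fun _ _ => of_eqvGen ih) (hR _ _ _ hr)) h

theorem ClcEq.of_condStep
    {R : (CLTerm V → CLTerm V → Prop) → CLTerm V → CLTerm V → Prop}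
    (hR : ∀ E l r, R E l r → CLCPlusRule E l r) {s t : CLTerm V}
    (h : ReflTransGen (CondStep R) s t) : ClcEq s t := by
  induction h with
  | refl => exact .refl _
  | tail _ h ih =>
    obtain ⟨n, hn⟩ := h
    exact .trans ih (of_levelStep hR n _ _ hn)

theorem CLCStep.of_rule {l r : CLTerm V} (h : CLCRule (fun _ _ => False) l r) :
    CLCStep l r :=
  ⟨0, .root h⟩

theorem CLCStep.condEq (z : CLTerm V) {x y : CLTerm V} (h : ClcEq x y) :
    CLCStep (C ⬝ z ⬝ x ⬝ y) x := by
  obtain ⟨n, hn⟩ := h.exists_level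
  exact ⟨n + 1, .root (.condEq z _ _ hn)⟩

theorem CLCStep.left {s s' : CLTerm V} (t : CLTerm V) (h : CLCStep s s') :
    CLCStep (s ⬝ t) (s' ⬝ t) :=
  h.imp fun _ => levelStep_left t

theorem CLCStep.right (s : CLTerm V) {t t' : CLTerm V} (h : CLCStep t t') :
    CLCStep (s ⬝ t) (s ⬝ t') :=
  h.imp fun _ => levelStep_right s

theorem reflTransGen_clcStep_app {s s' t t' : CLTerm V} (hs : ReflTransGen CLCStep s s')
    (ht : ReflTransGen CLCStep t t') : ReflTransGen CLCStep (s ⬝ t) (s' ⬝ t') :=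
  (hs.lift (· ⬝ t) fun _ _ => CLCStep.left t).trans
    (ht.lift (s' ⬝ ·) fun _ _ => CLCStep.right s')

theorem reflTransGen_clcStep_cond {z z' : CLTerm V} (x y : CLTerm V)
    (hz : ReflTransGen CLCStep z z') :
    ReflTransGen CLCStep (C ⬝ z ⬝ x ⬝ y) (C ⬝ z' ⬝ x ⬝ y) :=
  reflTransGen_clcStep_app (reflTransGen_clcStep_app
    (reflTransGen_clcStep_app .refl hz) .refl) .refl

/-! ### Head evaluation to a constant -/

/-- `Ev c t P`: the term `t` applied to the arguments `P` evaluates to the constant `c`. When the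
condition of a conditional is skipped because its branches are equal, both branches have to
evaluate to `c`; this makes the relation invariant under `ClcEq`. -/
inductive Ev : CLConst → CLTerm V → List (CLTerm V) → Prop
  | const (c) : Ev c (const c) []
  | push {c s t P} : Ev c s (t :: P) → Ev c (s ⬝ t) P
  | ruleK {c x P} (y) : Ev c x P → Ev c K (x :: y :: P)
  | ruleS {c x y z P} : Ev c x (z :: (y ⬝ z) :: P) → Ev c S (x :: y :: z :: P)
  | condT {c z x P} (y) : Ev .T z [] → Ev c x P → Ev c C (z :: x :: y :: P)
  | condF {c z y P} (x) : Ev .F z [] → Ev c y P → Ev c C (z :: x :: y :: P)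
  | condEq {c x y P} (z) : ClcEq x y → Ev c x P → Ev c y P → Ev c C (z :: x :: y :: P)

theorem ev_app {c : CLConst} {s t : CLTerm V} {P : List (CLTerm V)} :
    Ev c (s ⬝ t) P ↔ Ev c s (t :: P) :=
  ⟨fun h => by cases h; assumption, .push⟩

theorem Ev.reflTransGen {c : CLConst} {t : CLTerm V} {P : List (CLTerm V)} (h : Ev c t P) :
    ReflTransGen CLCStep (P.foldl app t) (.const c) := by
  have lift (P : List (CLTerm V)) {s t : CLTerm V} (h : ReflTransGen CLCStep s t) :
      ReflTransGen CLCStep (P.foldl app s) (P.foldl app t) := by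
    induction P generalizing s t with
    | nil => exact h
    | cons u P ih => exact ih (reflTransGen_clcStep_app h .refl)
  induction h with
  | const c => exact .refl
  | push _ ih => exact ih
  | ruleK y _ ih => exact (lift _ (.single (.of_rule (.ruleK _ _)))).trans ih
  | ruleS _ ih => exact (lift _ (.single (.of_rule (.ruleS _ _ _)))).trans ih
  | condT y _ _ ihz ih =>
    exact (lift _ ((reflTransGen_clcStep_cond _ _ ihz).tail (.of_rule (.condT _ _)))).trans ih
  | condF x _ _ ihz ih =>
    exact (lift _ ((reflTransGen_clcStep_cond _ _ ihz).tail (.of_rule (.condF _ _)))).trans ih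
  | condEq z hxy _ _ ih _ => exact (lift _ (.single (.condEq z hxy))).trans ih

/-- Provably equal terms that evaluate alike when applied to the same arguments. -/
def EvEquiv (s t : CLTerm V) : Prop :=
  ClcEq s t ∧ ∀ c P, Ev c s P ↔ Ev c t P

/-- Simultaneous replacement of disjoint subterms by `EvEquiv` ones. -/
inductive Repl : CLTerm V → CLTerm V → Prop
  | refl (s) : Repl s s
  | base {s t} : EvEquiv s t → Repl s t
  | app {s s' t t'} : Repl s s' → Repl t t' → Repl (s ⬝ t) (s' ⬝ t')

theorem Repl.clcEq {s t : CLTerm V} (h : Repl s t) : ClcEq s t := by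
  induction h with
  | refl s => exact .refl s
  | base h => exact h.1
  | app _ _ ih₁ ih₂ => exact .app ih₁ ih₂

theorem Repl.symm {s t : CLTerm V} (h : Repl s t) : Repl t s := by
  induction h with
  | refl s => exact .refl s
  | base h => exact .base ⟨h.1.symm, fun c P => (h.2 c P).symm⟩
  | app _ _ ih₁ ih₂ => exact .app ih₁ ih₂

theorem Repl.ev_of_const {c d : CLConst} {t : CLTerm V} {P : List (CLTerm V)}
    (h : Repl (.const d) t) (hd : Ev c (.const d) P) : Ev c t P := by
  cases h with
  | refl => exact hd
  | base h => exact (h.2 c P).1 hd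

/-- This yields the congruence case of `ClcEq.ev_iff`. Evaluation moves and copies arguments, so
head and arguments must be replaced together. -/
theorem Ev.repl {c : CLConst} {t t' : CLTerm V} {P P' : List (CLTerm V)} (h : Ev c t P)
    (ht : Repl t t') (hP : List.Forall₂ Repl P P') : Ev c t' P' := by
  induction h generalizing t' P' with
  | const c =>
    cases hP
    exact ht.ev_of_const (.const c)
  | push _ ih =>
    cases ht with
    | refl => exact .push (ih (.refl _) (.cons (.refl _) hP))
    -- The arguments are replaced under the old head, which is then exchanged by equivalence.
    | base h => exact (h.2 _ _).1 (.push (ih (.refl _) (.cons (.refl _) hP)))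
    | app hs ht => exact .push (ih hs (.cons ht hP))
  | ruleK y _ ih =>
    rcases hP with _ | ⟨hx, _ | ⟨hy, hP⟩⟩
    exact ht.ev_of_const (.ruleK _ (ih hx hP))
  | ruleS _ ih =>
    rcases hP with _ | ⟨hx, _ | ⟨hy, _ | ⟨hz, hP⟩⟩⟩
    exact ht.ev_of_const (.ruleS (ih hx (.cons hz (.cons (.app hy hz) hP))))
  | condT y _ _ ihz ih =>
    rcases hP with _ | ⟨hz, _ | ⟨hx, _ | ⟨hy, hP⟩⟩⟩
    exact ht.ev_of_const (.condT _ (ihz hz .nil) (ih hx hP))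
  | condF x _ _ ihz ih =>
    rcases hP with _ | ⟨hz, _ | ⟨hx, _ | ⟨hy, hP⟩⟩⟩
    exact ht.ev_of_const (.condF _ (ihz hz .nil) (ih hy hP))
  | condEq z hxy _ _ ihx ihy =>
    rcases hP with _ | ⟨hz, _ | ⟨hx, _ | ⟨hy, hP⟩⟩⟩
    exact ht.ev_of_const
      (.condEq _ (.trans hx.clcEq.symm (.trans hxy hy.clcEq)) (ihx hx hP) (ihy hy hP))

theorem Repl.ev_iff {s t : CLTerm V} (h : Repl s t) (c : CLConst) (P : List (CLTerm V)) :
    Ev c s P ↔ Ev c t P :=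
  have hP : List.Forall₂ Repl P P := List.forall₂_same.2 fun s _ => .refl s
  ⟨fun hs => hs.repl h hP, fun ht => ht.repl h.symm hP⟩

theorem not_ev_const {c d : CLConst} (h : c ≠ d) :
    ¬ Ev c (const d : CLTerm V) [] := by
  intro hd
  cases hd
  exact h rfl

/-- Evaluation is invariant under provable equality. -/
theorem ClcEq.ev_iff {s t : CLTerm V} (h : ClcEq s t) :
    ∀ (c : CLConst) (P : List (CLTerm V)), Ev c s P ↔ Ev c t P := by
  induction h with
  | refl s => exact fun _ _ => Iff.rfl
  | symm _ ih => exact fun c P => (ih c P).symm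
  | trans _ _ ih₁ ih₂ => exact fun c P => (ih₁ c P).trans (ih₂ c P)
  | app h₁ h₂ ih₁ ih₂ => exact (Repl.app (.base ⟨h₁, ih₁⟩) (.base ⟨h₂, ih₂⟩)).ev_iff
  | condT x y =>
    intro c P
    simp only [ev_app]
    refine ⟨fun h => ?_, .condT _ (.const _)⟩
    cases h with
    | condT _ _ hx => exact hx
    | condF _ hz _ => exact (not_ev_const (by simp) hz).elim
    | condEq _ _ hx _ => exact hx
  | condF x y =>
    intro c P
    simp only [ev_app]
    refine ⟨fun h => ?_, .condF _ (.const _)⟩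
    cases h with
    | condT _ hz _ => exact (not_ev_const (by simp) hz).elim
    | condF _ _ hy => exact hy
    -- Here the requirement that both branches evaluate is needed.
    | condEq _ _ _ hy => exact hy
  | condEq z hxy ih =>
    intro c P
    simp only [ev_app]
    refine ⟨fun h => ?_, fun hx => .condEq _ hxy hx ((ih c P).1 hx)⟩
    cases h with
    | condT _ _ hx => exact hx
    | condF _ _ hy => exact (ih c P).2 hy
    | condEq _ _ hx _ => exact hx
  | ruleK x y =>
    intro c P
    simp only [ev_app]
    exact ⟨fun h => by cases h; assumption, .ruleK _⟩
  | ruleS x y z =>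
    intro c P
    simp only [ev_app]
    exact ⟨fun h => by cases h; assumption, .ruleS⟩

theorem ClcEq.reduces_to_const {c : CLConst} {z : CLTerm V} (h : ClcEq z (const c)) :
    ReflTransGen CLCStep z (const c) :=
  ((h.ev_iff c []).2 (.const c)).reflTransGen

theorem not_clcEq_T_F : ¬ ClcEq (T : CLTerm V) F := fun h =>
  not_ev_const (by simp) ((h.ev_iff .T []).1 (.const _))

/-! ### Reduction with conditions decided by provable equality -/

/-- Parallel reduction in the system where the branch taken by a conditional is determined by
provable equality, the second branch having priority if the test is provably false. -/
inductive OPar : CLTerm V → CLTerm V → Prop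
  | var (v) : OPar (var v) (var v)
  | const (c) : OPar (const c) (const c)
  | app {s s' t t'} : OPar s s' → OPar t t' → OPar (s ⬝ t) (s' ⬝ t')
  | ruleK {x x'} (y) : OPar x x' → OPar (K ⬝ x ⬝ y) x'
  | ruleS {x x' y y' z z'} : OPar x x' → OPar y y' → OPar z z' →
      OPar (S ⬝ x ⬝ y ⬝ z) (x' ⬝ z' ⬝ (y' ⬝ z'))
  | fst {z x x' y} : ¬ ClcEq z F → ClcEq z T ∨ ClcEq x y → OPar x x' → OPar (C ⬝ z ⬝ x ⬝ y) x'
  | snd {z y y'} (x) : ClcEq z F → OPar y y' → OPar (C ⬝ z ⬝ x ⬝ y) y'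

theorem OPar.refl (s : CLTerm V) : OPar s s := by
  induction s with
  | var v => exact .var v
  | const c => exact .const c
  | app s t ihs iht => exact .app ihs iht

theorem ClcEq.cond_of_T {z : CLTerm V} (hz : ClcEq z T) (x y : CLTerm V) :
    ClcEq (C ⬝ z ⬝ x ⬝ y) x :=
  .trans (.app (.app (.app (.refl _) hz) (.refl _)) (.refl _)) (.condT x y)

theorem ClcEq.cond_of_F {z : CLTerm V} (hz : ClcEq z F) (x y : CLTerm V) :
    ClcEq (C ⬝ z ⬝ x ⬝ y) y :=
  .trans (.app (.app (.app (.refl _) hz) (.refl _)) (.refl _)) (.condF x y)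

theorem OPar.clcEq {s t : CLTerm V} (h : OPar s t) : ClcEq s t := by
  induction h with
  | var v => exact .refl _
  | const c => exact .refl _
  | app _ _ ih₁ ih₂ => exact .app ih₁ ih₂
  | ruleK y _ ih => exact .trans (.ruleK _ _) ih
  | ruleS _ _ _ ihx ihy ihz =>
    exact .trans (.ruleS _ _ _) (.app (.app ihx ihz) (.app ihy ihz))
  | fst _ h _ ih => exact .trans (h.elim (fun h => h.cond_of_T _ _) (.condEq _)) ih
  | snd x h _ ih => exact .trans (h.cond_of_F _ _) ih

open Classical in
/-- The complete development of a term with respect to `OPar`. -/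
noncomputable def star : CLTerm V → CLTerm V
  | const .K ⬝ x ⬝ _ => star x
  | const .S ⬝ x ⬝ y ⬝ z => star x ⬝ star z ⬝ (star y ⬝ star z)
  | const .C ⬝ z ⬝ x ⬝ y =>
    if ClcEq z F then star y
    else if ClcEq z T ∨ ClcEq x y then star x
    else C ⬝ star z ⬝ star x ⬝ star y
  | s ⬝ t => star s ⬝ star t
  | s => s

theorem OPar.const_inv {c : CLConst} {t : CLTerm V} (h : OPar (.const c) t) : t = .const c := by
  cases h
  rfl

theorem OPar.const_app_inv {c : CLConst} {x t : CLTerm V} (h : OPar (.const c ⬝ x) t) :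
    ∃ x', t = .const c ⬝ x' ∧ OPar x x' := by
  cases h with
  | app hs ht => exact ⟨_, by rw [hs.const_inv], ht⟩

/-- Only `K` forms a redex with two arguments. -/
theorem OPar.const_app_app_inv {c : CLConst} (hc : c ≠ .K) {x y t : CLTerm V}
    (h : OPar (.const c ⬝ x ⬝ y) t) :
    ∃ x' y', t = .const c ⬝ x' ⬝ y' ∧ OPar x x' ∧ OPar y y' := by
  cases h with
  | app hs ht =>
    obtain ⟨x', rfl, hx⟩ := hs.const_app_inv
    exact ⟨x', _, rfl, hx, ht⟩
  | ruleK => exact (hc rfl).elim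

/-- The triangle property: every parallel reduct of `s` reduces to the complete development. -/
theorem OPar.star {s t : CLTerm V} (h : OPar s t) : OPar t s.star := by
  induction h with
  | var v => simpa [CLTerm.star] using OPar.var v
  | const c => simpa [CLTerm.star] using OPar.const c
  | @app s s' t t' hs ht ihs iht =>
    unfold CLTerm.star
    split
    · rename_i x y heq
      cases heq
      obtain ⟨x', rfl, hx⟩ := hs.const_app_inv
      simp only [CLTerm.star] at ihs
      obtain ⟨x'', hx', hx''⟩ := ihs.const_app_inv
      cases hx'
      exact .ruleK _ hx''
    · rename_i x y z heq
      cases heq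
      obtain ⟨x', y', rfl, hx, hy⟩ := hs.const_app_app_inv (by simp)
      simp only [CLTerm.star] at ihs
      obtain ⟨x'', y'', h', hx'', hy''⟩ := ihs.const_app_app_inv (by simp)
      cases h'
      exact .ruleS hx'' hy'' iht
    · rename_i z x y heq
      cases heq
      obtain ⟨z', x', rfl, hz, hx⟩ := hs.const_app_app_inv (by simp)
      simp only [CLTerm.star] at ihs
      obtain ⟨z'', x'', h', hz'', hx''⟩ := ihs.const_app_app_inv (by simp)
      cases h'
      split_ifs with h₁ h₂
      -- Reduction stays within `ClcEq`, so the conditions still hold, or fail, for the reducts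
      -- `z'`, `x'`, `t'`.
      · exact .snd _ (hz.clcEq.symm.trans h₁) iht
      · exact .fst (fun h => h₁ (hz.clcEq.trans h))
          (h₂.imp (hz.clcEq.symm.trans ·) fun h => hx.clcEq.symm.trans (h.trans ht.clcEq)) hx''
      · exact .app ihs iht
    · rename_i heq
      cases heq
      exact .app ihs iht
    · rename_i h
      exact (h s t rfl).elim
  | ruleK y _ ih => simpa only [CLTerm.star] using ih
  | ruleS _ _ _ ihx ihy ihz =>
    simpa only [CLTerm.star] using OPar.app (.app ihx ihz) (.app ihy ihz)
  | fst h₁ h₂ _ ih => simpa only [CLTerm.star, if_neg h₁, if_pos h₂] using ih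
  | snd x h _ ih => simpa only [CLTerm.star, if_pos h] using ih

/-! ### Church–Rosser property and transfer to the two systems -/

theorem OPar.join_trans {s t u : CLTerm V} (h₁ : Join (ReflTransGen OPar) s t)
    (h₂ : Join (ReflTransGen OPar) t u) : Join (ReflTransGen OPar) s u := by
  obtain ⟨v, hsv, htv⟩ := h₁
  obtain ⟨w, htw, huw⟩ := h₂
  obtain ⟨d, hvd, hwd⟩ := church_rosser
    (fun a _ _ hb hc => ⟨a.star, .single hb.star, .single hc.star⟩) htv htw
  exact ⟨d, hsv.trans hvd, huw.trans hwd⟩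

theorem OPar.reflTransGen_app {s s' t t' : CLTerm V} (hs : ReflTransGen OPar s s')
    (ht : ReflTransGen OPar t t') : ReflTransGen OPar (s ⬝ t) (s' ⬝ t') :=
  (hs.lift (· ⬝ t) fun _ _ h => .app h (.refl t)).trans
    (ht.lift (s' ⬝ ·) fun _ _ h => .app (.refl s') h)

theorem OPar.join {s t : CLTerm V} (h : OPar s t) : Join (ReflTransGen OPar) s t :=
  ⟨t, .single h, .refl⟩

theorem ClcEq.join_oPar {s t : CLTerm V} (h : ClcEq s t) : Join (ReflTransGen OPar) s t := by
  induction h with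
  | refl s => exact ⟨s, .refl, .refl⟩
  | symm _ ih => exact let ⟨u, h₁, h₂⟩ := ih; ⟨u, h₂, h₁⟩
  | trans _ _ ih₁ ih₂ => exact OPar.join_trans ih₁ ih₂
  | app _ _ ih₁ ih₂ =>
    obtain ⟨u, h₁, h₂⟩ := ih₁
    obtain ⟨v, h₃, h₄⟩ := ih₂
    exact ⟨u ⬝ v, OPar.reflTransGen_app h₁ h₃, OPar.reflTransGen_app h₂ h₄⟩
  -- Because `F` has priority, this contraction needs consistency, `T ≠ F`.
  | condT x y => exact (OPar.fst not_clcEq_T_F (.inl (.refl _)) (.refl x)).join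
  | condF x y => exact (OPar.snd x (.refl _) (.refl y)).join
  | @condEq z x y hxy ih =>
    -- If `z = F`, priority forces the contraction to `y`, and the induction hypothesis joins `y`
    -- with `x`.
    by_cases hz : ClcEq z F
    · obtain ⟨u, hx, hy⟩ := ih
      exact ⟨u, .head (OPar.snd x hz (.refl y)) hy, hx⟩
    · exact (OPar.fst hz (.inr hxy) (.refl x)).join
  | ruleK x y => exact (OPar.ruleK y (.refl x)).join
  | ruleS x y z => exact (OPar.ruleS (.refl x) (.refl y) (.refl z)).join

/-- A provably true or false test is first reduced to its constant, after which an unconditional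
rule applies. -/
theorem OPar.reflTransGen_clcStep {s t : CLTerm V} (h : OPar s t) :
    ReflTransGen CLCStep s t := by
  induction h with
  | var v => exact .refl
  | const c => exact .refl
  | app _ _ ih₁ ih₂ => exact reflTransGen_clcStep_app ih₁ ih₂
  | ruleK y _ ih => exact .head (.of_rule (.ruleK _ _)) ih
  | ruleS _ _ _ ihx ihy ihz =>
    exact .head (.of_rule (.ruleS _ _ _))
      (reflTransGen_clcStep_app (reflTransGen_clcStep_app ihx ihz)
        (reflTransGen_clcStep_app ihy ihz))
  | fst _ h _ ih =>
    rcases h with hz | hxy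
    · exact (reflTransGen_clcStep_cond _ _ hz.reduces_to_const).trans
        (.head (.of_rule (.condT _ _)) ih)
    · exact .head (.condEq _ hxy) ih
  | snd x hz _ ih =>
    exact (reflTransGen_clcStep_cond _ _ hz.reduces_to_const).trans
      (.head (.of_rule (.condF _ _)) ih)

/-- Provably equal terms have a common reduct in `CLC`. -/
theorem ClcEq.join_clcStep {s t : CLTerm V} (h : ClcEq s t) :
    Join (ReflTransGen CLCStep) s t := by
  obtain ⟨u, hs, ht⟩ := h.join_oPar
  have lift {a b : CLTerm V} (h : ReflTransGen OPar a b) : ReflTransGen CLCStep a b := by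
    induction h with
    | refl => exact .refl
    | tail _ h ih => exact ih.trans h.reflTransGen_clcStep
  exact ⟨u, lift hs, lift ht⟩

theorem levelStep_clcPlusRule {n : ℕ} : ∀ {s t : CLTerm V},
    LevelStep CLCRule n s t → LevelStep CLCPlusRule n s t := by
  induction n with
  | zero => exact fun h => ContextClosure.mono (fun _ _ => .ofCLC) h
  | succ n ih =>
    exact fun h => ContextClosure.mono
      (fun _ _ hr => .ofCLC (hr.mono fun _ _ => eqvGen_lift id fun _ _ => ih)) h

theorem CLCStep.clcPlusStep {s t : CLTerm V} (h : CLCStep s t) : CLCPlusStep s t :=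
  h.imp fun _ => levelStep_clcPlusRule

end CLTerm

theorem mainTheorem1 (V : Type*) :
    IsConfluent (CLCStep : CLTerm V → CLTerm V → Prop) ∧
      IsConfluent (CLCPlusStep : CLTerm V → CLTerm V → Prop) := by
  constructor
  · intro a b c hb hc
    have hR (E : CLTerm V → CLTerm V → Prop) (l r) : CLCRule E l r → CLCPlusRule E l r := .ofCLC
    exact ((ClcEq.of_condStep hR hb).symm.trans (ClcEq.of_condStep hR hc)).join_clcStep
  · intro a b c hb hc
    have hR (E : CLTerm V → CLTerm V → Prop) (l r) : CLCPlusRule E l r → CLCPlusRule E l r := id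
    obtain ⟨d, h₁, h₂⟩ :=
      ((ClcEq.of_condStep hR hb).symm.trans (ClcEq.of_condStep hR hc)).join_clcStep
    -- The common reduct is reached by `CLC` steps alone, which are also `CLC⁺` steps.
    exact ⟨d, h₁.lift id fun _ _ => CLCStep.clcPlusStep, h₂.lift id fun _ _ => CLCStep.clcPlusStep⟩
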